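/- Let $N \ge 0$ be an integer and let $\{A(t)\}_{t\ge 0}$, $A(t)=(a_{ij}(t))_{1\le i,j\le N}$, be a chain of real $N\times N$ matrices such that every $A(t)$ has zero row sums and non-negative off-diagonal entries, and every entry $a_{ij}$ is a measurable function that is integrable on every bounded interval $[0,T]$. For $t\ge\tau\ge 0$ let $\Phi(t,\tau)$ be the state transition matrix of $\dot x(t)=A(t)x(t)$, given by the Peano–Baker series $$\Phi(t,\tau)=I+\int_\tau^t A(\sigma_1)\,d\sigma_1+\int_\tau^t A(\sigma_1)\int_\tau^{\sigma_1}A(\sigma_2)\,d\sigma_2\,d\sigma_1+\cdots .$$ For $\tau\ge 0$ let $\mathrm{Null}_\tau(A)=\{v\in\mathbb{R}^N : \lim_{t\to\infty}\Phi(t,\tau)v=0\}$. Then the dimension of $\mathrm{Null}_\tau(A)$ is the same for all $\tau\ge 0$; call it $\mathrm{Nullity}(A)$, and put $\mathrm{Rank}(A)=N-\mathrm{Nullity}(A)$. The unbounded interactions graph of the chain is the directed graph on $\{1,\dots,N\}$ with an edge $i\to j$, for distinct $i,j$, if and only if $\int_0^\infty a_{ji}(t)\,dt=\infty$. An s-root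 of a directed graph is a set $S$ of nodes such that every node is in $S$ or is reachable by a directed path from some node of $S$. Then $\mathrm{Rank}(A)$ is greater than or equal to the size of the smallest s-root of the unbounded interactions graph of $\{A(t)\}$. -/

import Mathlib

open MeasureTheory Filter Topology

namespace OpinionNetwork

/-- A continuous-time chain `{A(t)}` (only the times `t ≥ 0` matter): every `A t` has
non-negative off-diagonal entries and zero row sums, and every entry is a measurable function of
time whose integral over each bounded interval of times is finite (`LocallyIntegrableOn` contains
Lebesgue measurability), so that the dynamics `x' = A(t) x` has a state transition matrix. -/
structure IsTimeChain {N : ℕ} (A : ℝ → Matrix (Fin N) (Fin N) ℝ) : Prop where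
  offDiag_nonneg : ∀ t : ℝ, 0 ≤ t → ∀ i j : Fin N, i ≠ j → 0 ≤ A t i j
  row_sum : ∀ t : ℝ, 0 ≤ t → ∀ i : Fin N, ∑ j, A t i j = 0
  locallyIntegrable : ∀ i j : Fin N,
    LocallyIntegrableOn (fun t : ℝ => A t i j) (Set.Ici 0) volume

/-- The `n`-th term of the Peano–Baker series at `(t, τ)`: the identity matrix for `n = 0`, and
`∫_τ^t A(s) P_n(s, τ) ds` (entrywise) for the term of index `n + 1`. -/
noncomputable def peanoBaker {N : ℕ} (A : ℝ → Matrix (Fin N) (Fin N) ℝ) :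
    ℕ → ℝ → ℝ → Matrix (Fin N) (Fin N) ℝ
  | 0, _, _ => 1
  | n + 1, t, τ => Matrix.of fun i j => ∫ s in τ..t, (A s * peanoBaker A n s τ) i j

/-- The state transition matrix `Φ(t, τ)` of the chain: the sum of the Peano–Baker series. -/
noncomputable def transition {N : ℕ} (A : ℝ → Matrix (Fin N) (Fin N) ℝ) (t τ : ℝ) :
    Matrix (Fin N) (Fin N) ℝ :=
  Matrix.of fun i j => ∑' n : ℕ, peanoBaker A n t τ i j

/-- The null space of the chain at time `τ`: all `v` with `Φ(t, τ) v → 0` as `t → ∞`. -/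
def nullSpace {N : ℕ} (A : ℝ → Matrix (Fin N) (Fin N) ℝ) (τ : ℝ) :
    Submodule ℝ (Fin N → ℝ) where
  carrier := {v | Tendsto (fun t : ℝ => (transition A t τ).mulVec v) atTop (𝓝 0)}
  zero_mem' := by simp
  add_mem' := by
    intro v w hv hw
    simpa [Matrix.mulVec_add] using Tendsto.add hv hw
  smul_mem' := by
    intro c v hv
    simpa [Matrix.mulVec_smul] using Tendsto.const_smul hv c

/-- The nullity of a chain: the dimension of its null spaces, read off at time `0` (the theorem
also asserts that this dimension is the same at all times `τ ≥ 0`). -/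
noncomputable def nullity {N : ℕ} (A : ℝ → Matrix (Fin N) (Fin N) ℝ) : ℕ :=
  Module.finrank ℝ (nullSpace A 0)

/-- The rank of a chain of `N × N` matrices: `N` minus its nullity (which is at most `N`). -/
noncomputable def rank {N : ℕ} (A : ℝ → Matrix (Fin N) (Fin N) ℝ) : ℕ :=
  N - nullity A

/-- The unbounded interactions graph: an edge from `i` to `j ≠ i` iff `∫_0^∞ a_{ji}(t) dt = ∞`. -/
def unboundedInteractions {N : ℕ} (A : ℝ → Matrix (Fin N) (Fin N) ℝ) : Digraph (Fin N) where
  Adj i j := i ≠ j ∧ ∫⁻ t in Set.Ici (0 : ℝ), ENNReal.ofReal (A t j i) = ⊤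

/-- `S` is an s-root of the directed graph `H`: each node lies in `S` or can be reached from a
node of `S` along a directed path. -/
def IsSRoot {V : Type*} (H : Digraph V) (S : Finset V) : Prop :=
  ∀ i : V, i ∈ S ∨ ∃ j ∈ S, Relation.TransGen H.Adj j i

/-- The size of the smallest s-root of a finite directed graph. -/
noncomputable def minSRootSize {V : Type*} (H : Digraph V) : ℕ :=
  sInf {n : ℕ | ∃ S : Finset V, IsSRoot H S ∧ S.card = n}

/-- On a finite graph the size of the smallest s-root is attained. -/
theorem exists_isSRoot_card_eq {V : Type*} [Fintype V] (H : Digraph V) :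
    ∃ S : Finset V, IsSRoot H S ∧ S.card = minSRootSize H :=
  Nat.sInf_mem (s := {n : ℕ | ∃ S : Finset V, IsSRoot H S ∧ S.card = n})
    ⟨_, Finset.univ, fun i => Or.inl (Finset.mem_univ i), rfl⟩

end OpinionNetwork

namespace OpinionNetwork

/-! Let S be a smallest s-root and, for r in S, let K_r be the set of nodes with a (possibly
trivial) path to r in the unbounded interactions graph. No edge enters K_r from outside, so the
total influence of the complement on K_r is integrable over all time. The sets K_r are disjoint: a
common ancestor of r and r' could replace both in S, contradicting minimality
(`eq_of_reaches_of_card_eq_minSRootSize`).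

Start at a time τ so late that every K_r receives at most 1/4 of inflow afterwards. The indicator of
K_r, propagated from τ, then stays at least 3/4 at r (`one_sub_integral_inflow_le`). Since Φ(t, τ)
is row stochastic for t ≥ τ, the other indicators together contribute at most 1/4 there. A nonzero
combination of the indicators, read at a node with largest coefficient in absolute value, therefore
never decays. Their span has dimension |S| and meets the null space at τ only in 0, so |S| plus the
nullity is at most N (`card_add_nullity_le`).

The nullity does not depend on τ because Φ(τ, 0) is invertible with inverse Φ(0, τ). This is why the
Peano–Baker series is treated for both orders of its two times. The entries of A being merely
locally integrable, the differential equation is used in integral form, and positivity comes from a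
minimum principle of that form (`nonneg_of_supersolution`). -/

/-! ### Primitives of locally integrable functions -/

/-- A function that is locally integrable on the half-line `t ≥ 0` is interval integrable between
any two non-negative times. -/
theorem intervalIntegrable_of_locallyIntegrableOn_Ici {f : ℝ → ℝ}
    (hf : LocallyIntegrableOn f (Set.Ici 0) volume) {a b : ℝ} (ha : 0 ≤ a) (hb : 0 ≤ b) :
    IntervalIntegrable f volume a b := by
  rw [intervalIntegrable_iff']
  refine hf.integrableOn_compact_subset (fun x hx => ?_) isCompact_uIcc
  exact le_trans (le_min ha hb) hx.1

theorem continuousOn_primitive_Ici {f : ℝ → ℝ}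
    (hf : ∀ a b : ℝ, 0 ≤ a → 0 ≤ b → IntervalIntegrable f volume a b) {τ : ℝ} (hτ : 0 ≤ τ) :
    ContinuousOn (fun t => ∫ s in τ..t, f s) (Set.Ici 0) := by
  intro t ht
  have ht : 0 ≤ t := ht
  have h1 : ContinuousOn (fun t => ∫ s in τ..t, f s) (Set.uIcc 0 (max τ t + 1)) := by
    apply intervalIntegral.continuousOn_primitive_interval'
      (hf 0 (max τ t + 1) le_rfl (by positivity))
    rw [Set.uIcc_of_le (by positivity)]
    exact ⟨hτ, by linarith [le_max_left τ t]⟩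
  rw [Set.uIcc_of_le (by positivity)] at h1
  have h2 : t < max τ t + 1 := by linarith [le_max_right τ t]
  refine (h1 t ⟨ht, h2.le⟩).mono_of_mem_nhdsWithin ?_
  filter_upwards [self_mem_nhdsWithin, mem_nhdsWithin_of_mem_nhds (Iio_mem_nhds h2)] with u hu hu'
  exact ⟨hu, le_of_lt hu'⟩

/-- The powers of the primitive `G` of an integrable function `g` satisfy
`∫ g G ^ n = G ^ (n + 1) / (n + 1)`. -/
theorem integral_mul_primitive_pow {g : ℝ → ℝ} {a b : ℝ}
    (hg : IntervalIntegrable g volume a b) (n : ℕ) :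
    ∫ s in a..b, g s * (∫ u in a..s, g u) ^ n = (∫ u in a..b, g u) ^ (n + 1) / (n + 1) := by
  have hac := hg.absolutelyContinuousOnInterval_intervalIntegral (c := a) Set.left_mem_uIcc
  -- The primitive is differentiable only almost everywhere, so the fundamental theorem of calculus
  -- is applied to its powers as absolutely continuous functions.
  have hpow : ∀ m : ℕ, AbsolutelyContinuousOnInterval
      (fun s => (∫ u in a..s, g u) ^ (m + 1)) a b := by
    intro m
    induction m with
    | zero => simpa using hac
    | succ m ih =>
      have := ih.mul hac
      refine (congrArg (fun h => AbsolutelyContinuousOnInterval h a b) ?_).mp this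
      funext s
      simp [pow_succ]
  have h := (hpow n).integral_deriv_eq_sub
  have h2 : ∫ s in a..b, deriv (fun s => (∫ u in a..s, g u) ^ (n + 1)) s =
      ∫ s in a..b, (n + 1) * (g s * (∫ u in a..s, g u) ^ n) := by
    apply intervalIntegral.integral_congr_ae
    filter_upwards [hg.ae_hasDerivAt_integral] with s hs hs'
    have := (hs (Set.uIoc_subset_uIcc hs') a Set.left_mem_uIcc).pow (n + 1)
    rw [HasDerivAt.deriv (f' := (n + 1) * (g s * (∫ u in a..s, g u) ^ n))]
    convert! this using 1
    push_cast
    ring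
  rw [h2, intervalIntegral.integral_const_mul] at h
  simp only [intervalIntegral.integral_same] at h
  have : (n + 1 : ℝ) ≠ 0 := by positivity
  field_simp
  rw [mul_comm]
  simpa using h

/-- On either orientation of the interval the primitive has constant sign, so its absolute value
differs from it by a factor c = ±1 that leaves the integral. The case b < a serves the transition
matrix run backwards. -/
theorem abs_integral_mul_abs_primitive_pow {g : ℝ → ℝ} {a b : ℝ}
    (hg : IntervalIntegrable g volume a b) (h0 : ∀ s, 0 ≤ g s) (n : ℕ) :
    |∫ s in a..b, g s * |∫ u in a..s, g u| ^ n| = |∫ u in a..b, g u| ^ (n + 1) / (n + 1) := by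
  have hn : |(n + 1 : ℝ)| = n + 1 := abs_of_pos (by positivity)
  have key : ∃ c : ℝ, |c| = 1 ∧ ∀ s ∈ Set.uIcc a b,
      |∫ u in a..s, g u| = c * ∫ u in a..s, g u := by
    rcases le_total a b with h | h
    · refine ⟨1, by simp, fun s hs => ?_⟩
      rw [Set.uIcc_of_le h] at hs
      rw [one_mul, abs_of_nonneg (intervalIntegral.integral_nonneg_of_forall hs.1 h0)]
    · refine ⟨-1, by simp, fun s hs => ?_⟩
      rw [Set.uIcc_of_ge h] at hs
      rw [neg_one_mul, intervalIntegral.integral_symm, abs_neg, neg_neg,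
        abs_of_nonneg (intervalIntegral.integral_nonneg_of_forall hs.2 h0)]
  obtain ⟨c, hc, hc'⟩ := key
  have : ∫ s in a..b, g s * |∫ u in a..s, g u| ^ n =
      ∫ s in a..b, c ^ n * (g s * (∫ u in a..s, g u) ^ n) := by
    apply intervalIntegral.integral_congr
    intro s hs
    simp only
    rw [hc' s hs]
    ring
  rw [this, intervalIntegral.integral_const_mul, integral_mul_primitive_pow hg, abs_mul, abs_pow,
    hc, one_pow, one_mul, abs_div, abs_pow, hn]

/-! ### Convergence of the Peano–Baker series -/

/-- The sum of the absolute values of all entries of `A s`. -/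
noncomputable def absSum {N : ℕ} (A : ℝ → Matrix (Fin N) (Fin N) ℝ) (s : ℝ) : ℝ :=
  ∑ i, ∑ j, |A s i j|

/-- All entries are locally integrable on `t ≥ 0`. -/
def EntriesIntegrable {N : ℕ} (A : ℝ → Matrix (Fin N) (Fin N) ℝ) : Prop :=
  ∀ i j : Fin N, LocallyIntegrableOn (fun t : ℝ => A t i j) (Set.Ici 0) volume

variable {N : ℕ} {A : ℝ → Matrix (Fin N) (Fin N) ℝ}

theorem absSum_nonneg (s : ℝ) : 0 ≤ absSum A s :=
  Finset.sum_nonneg fun _ _ => Finset.sum_nonneg fun _ _ => abs_nonneg _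

theorem sum_abs_row_le_absSum (s : ℝ) (i : Fin N) : ∑ j, |A s i j| ≤ absSum A s :=
  Finset.single_le_sum (f := fun i => ∑ j, |A s i j|)
    (fun _ _ => Finset.sum_nonneg fun _ _ => abs_nonneg _) (Finset.mem_univ i)

namespace EntriesIntegrable

theorem entry (hA : EntriesIntegrable A) (i j : Fin N) (a b : ℝ) (ha : 0 ≤ a) (hb : 0 ≤ b) :
    IntervalIntegrable (fun t => A t i j) volume a b :=
  intervalIntegrable_of_locallyIntegrableOn_Ici (hA i j) ha hb

theorem absSum (hA : EntriesIntegrable A) (a b : ℝ) (ha : 0 ≤ a) (hb : 0 ≤ b) :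
    IntervalIntegrable (absSum A) volume a b := by
  have : OpinionNetwork.absSum A = ∑ i : Fin N, ∑ j : Fin N, fun s => |A s i j| := by
    funext s
    simp [OpinionNetwork.absSum]
  rw [this]
  exact IntervalIntegrable.sum _ fun i _ => IntervalIntegrable.sum _ fun j _ =>
    (hA.entry i j a b ha hb).abs

/-- Coefficients times a continuous function are integrable. -/
theorem sum_mul (hA : EntriesIntegrable A) (i : Fin N) (K : Finset (Fin N)) {x : Fin N → ℝ → ℝ}
    {a b : ℝ} (ha : 0 ≤ a) (hb : 0 ≤ b)
    (hx : ∀ j ∈ K, ContinuousOn (x j) (Set.uIcc a b)) :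
    IntervalIntegrable (fun s => ∑ j ∈ K, A s i j * x j s) volume a b := by
  have : (fun s => ∑ j ∈ K, A s i j * x j s) = ∑ j ∈ K, fun s => A s i j * x j s := by
    funext s
    simp
  rw [this]
  exact IntervalIntegrable.sum _ fun j hj => (hA.entry i j a b ha hb).mul_continuousOn (hx j hj)

end EntriesIntegrable

theorem uIcc_subset_Ici_zero {a b : ℝ} (ha : 0 ≤ a) (hb : 0 ≤ b) :
    Set.uIcc a b ⊆ Set.Ici 0 := fun _ hx => le_trans (le_min ha hb) hx.1

theorem peanoBaker_succ_apply (n : ℕ) (t τ : ℝ) (i j : Fin N) :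
    peanoBaker A (n + 1) t τ i j = ∫ s in τ..t, ∑ k, A s i k * peanoBaker A n s τ k j := by
  simp [peanoBaker, Matrix.mul_apply]

theorem continuousOn_peanoBaker (hA : EntriesIntegrable A) {τ : ℝ} (hτ : 0 ≤ τ) (n : ℕ)
    (i j : Fin N) : ContinuousOn (fun t => peanoBaker A n t τ i j) (Set.Ici 0) := by
  induction n generalizing i j with
  | zero => simpa [peanoBaker] using continuousOn_const
  | succ n ih =>
    simp only [peanoBaker_succ_apply]
    refine continuousOn_primitive_Ici (fun a b ha hb => ?_) hτ
    exact hA.sum_mul i _ ha hb fun k _ => (ih k j).mono (uIcc_subset_Ici_zero ha hb)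

theorem intervalIntegrable_mul_peanoBaker (hA : EntriesIntegrable A) {τ a b : ℝ} (hτ : 0 ≤ τ)
    (ha : 0 ≤ a) (hb : 0 ≤ b) (n : ℕ) (i j : Fin N) :
    IntervalIntegrable (fun s => ∑ k, A s i k * peanoBaker A n s τ k j) volume a b :=
  hA.sum_mul i _ ha hb fun k _ =>
    (continuousOn_peanoBaker hA hτ n k j).mono (uIcc_subset_Ici_zero ha hb)

theorem abs_sum_mul_le (s c : ℝ) (x : Fin N → ℝ) (hx : ∀ k, |x k| ≤ c) (i : Fin N) :
    |∑ k, A s i k * x k| ≤ absSum A s * c := by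
  have hc : 0 ≤ c := (abs_nonneg _).trans (hx i)
  calc |∑ k, A s i k * x k| ≤ ∑ k, |A s i k| * c := by
        refine (Finset.abs_sum_le_sum_abs _ _).trans (Finset.sum_le_sum fun k _ => ?_)
        rw [abs_mul]
        exact mul_le_mul_of_nonneg_left (hx k) (abs_nonneg _)
    _ ≤ absSum A s * c := by
        rw [← Finset.sum_mul]
        exact mul_le_mul_of_nonneg_right (sum_abs_row_le_absSum s i) hc

/-- Each iterated integral raises the power of the primitive of `absSum A` by one and divides by the
new exponent, which builds up the factorial. The series is thus dominated by an exponential series,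
whichever of t and τ is larger. -/
theorem abs_peanoBaker_le (hA : EntriesIntegrable A) {t τ : ℝ} (ht : 0 ≤ t) (hτ : 0 ≤ τ) (n : ℕ)
    (i j : Fin N) :
    |peanoBaker A n t τ i j| ≤ |∫ s in τ..t, absSum A s| ^ n / n.factorial := by
  induction n generalizing i j t with
  | zero =>
    simp only [peanoBaker, Matrix.one_apply]
    split_ifs <;> simp
  | succ n ih =>
    have hint := hA.absSum τ t hτ ht
    rw [peanoBaker_succ_apply]
    have hcont : ContinuousOn (fun s => |∫ u in τ..s, absSum A u| ^ n / n.factorial)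
        (Set.uIcc τ t) :=
      (((continuousOn_primitive_Ici hA.absSum hτ).mono
        (uIcc_subset_Ici_zero hτ ht)).abs.pow n).div_const _
    calc |∫ s in τ..t, ∑ k, A s i k * peanoBaker A n s τ k j|
        ≤ |∫ s in τ..t, absSum A s * (|∫ u in τ..s, absSum A u| ^ n / n.factorial)| := by
          have hae : ∀ᵐ s ∂volume.restrict (Set.uIoc τ t),
              ‖∑ k, A s i k * peanoBaker A n s τ k j‖ ≤
                absSum A s * (|∫ u in τ..s, absSum A u| ^ n / n.factorial) := by
            refine (ae_restrict_iff' measurableSet_uIoc).2 (Eventually.of_forall fun s hs => ?_)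
            have hs0 : 0 ≤ s := uIcc_subset_Ici_zero hτ ht (Set.uIoc_subset_uIcc hs)
            exact abs_sum_mul_le s _ _ (fun k => ih hs0 k j) i
          exact intervalIntegral.norm_integral_le_abs_of_norm_le hae
            (hint.mul_continuousOn hcont)
      _ = |∫ s in τ..t, absSum A s| ^ (n + 1) / (n + 1).factorial := by
          have h := abs_integral_mul_abs_primitive_pow hint absSum_nonneg n
          have h2 : ∀ s, absSum A s * (|∫ u in τ..s, absSum A u| ^ n / n.factorial) =
              (n.factorial : ℝ)⁻¹ * (absSum A s * |∫ u in τ..s, absSum A u| ^ n) := by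
            intro s; ring
          simp only [h2]
          rw [intervalIntegral.integral_const_mul, abs_mul, h, Nat.factorial_succ]
          rw [abs_of_pos (by positivity)]
          push_cast
          field_simp

theorem summable_abs_peanoBaker (hA : EntriesIntegrable A) {t τ : ℝ} (ht : 0 ≤ t) (hτ : 0 ≤ τ)
    (i j : Fin N) : Summable fun n => ‖peanoBaker A n t τ i j‖ :=
  Summable.of_nonneg_of_le (fun _ => norm_nonneg _) (fun n => abs_peanoBaker_le hA ht hτ n i j)
    (Real.summable_pow_div_factorial _)

theorem hasSum_transition (hA : EntriesIntegrable A) {t τ : ℝ} (ht : 0 ≤ t) (hτ : 0 ≤ τ)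
    (i j : Fin N) : HasSum (fun n => peanoBaker A n t τ i j) (transition A t τ i j) :=
  (summable_abs_peanoBaker hA ht hτ i j).of_norm.hasSum

/-! ### Composition of transition matrices -/

/-- Chen's identity for the terms of the Peano–Baker series. -/
theorem peanoBaker_eq_sum_antidiagonal (hA : EntriesIntegrable A) {t s τ : ℝ} (ht : 0 ≤ t)
    (hs : 0 ≤ s) (hτ : 0 ≤ τ) (n : ℕ) :
    peanoBaker A n t τ =
      ∑ p ∈ Finset.HasAntidiagonal.antidiagonal n, peanoBaker A p.1 t s * peanoBaker A p.2 s τ := by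
  induction n generalizing t with
  | zero => simp [peanoBaker]
  | succ n ih =>
    rw [Finset.Nat.antidiagonal_succ, Finset.sum_cons, Finset.sum_map]
    ext i j
    -- Cut the outer integral at s. The part from τ to s is the summand with index (0, n + 1); in
    -- the part from s to t the induction hypothesis is inserted under the integral.
    rw [peanoBaker_succ_apply, ← intervalIntegral.integral_add_adjacent_intervals
      (intervalIntegrable_mul_peanoBaker hA hτ hτ hs n i j)
      (intervalIntegrable_mul_peanoBaker hA hτ hs ht n i j), ← peanoBaker_succ_apply]
    have h0 : peanoBaker A 0 t s = 1 := rfl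
    simp only [Matrix.add_apply, h0, Matrix.one_mul, Matrix.sum_apply,
      Function.Embedding.prodMap, Function.Embedding.coeFn_mk, Prod.map,
      Function.Embedding.refl_apply]
    congr 1
    have h1 : ∫ u in s..t, ∑ k, A u i k * peanoBaker A n u τ k j =
        ∫ u in s..t, ∑ p ∈ Finset.HasAntidiagonal.antidiagonal n, ∑ l,
          (∑ k, A u i k * peanoBaker A p.1 u s k l) * peanoBaker A p.2 s τ l j := by
      apply intervalIntegral.integral_congr
      intro u hu
      have hu0 : 0 ≤ u := uIcc_subset_Ici_zero hs ht hu
      have h2 : ∑ k, A u i k * peanoBaker A n u τ k j = (A u * peanoBaker A n u τ) i j :=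
        (Matrix.mul_apply).symm
      simp only
      rw [h2, ih hu0, Matrix.mul_sum, Matrix.sum_apply]
      refine Finset.sum_congr rfl fun p _ => ?_
      rw [← Matrix.mul_assoc, Matrix.mul_apply]
      simp only [Matrix.mul_apply]
    have hI : ∀ p : ℕ × ℕ, ∀ l, IntervalIntegrable (fun u =>
        (∑ k, A u i k * peanoBaker A p.1 u s k l) * peanoBaker A p.2 s τ l j) volume s t :=
      fun p l => (intervalIntegrable_mul_peanoBaker hA hs hs ht p.1 i l).mul_const _
    rw [h1, intervalIntegral.integral_finsetSum]
    · refine Finset.sum_congr rfl fun p _ => ?_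
      rw [intervalIntegral.integral_finsetSum fun l _ => hI p l, Matrix.mul_apply]
      refine Finset.sum_congr rfl fun l _ => ?_
      rw [intervalIntegral.integral_mul_const, peanoBaker_succ_apply]
    · intro p _
      have := IntervalIntegrable.sum Finset.univ fun l (_ : l ∈ Finset.univ) => hI p l
      convert! this using 1
      funext u
      simp

/-- This is the Cauchy product of two absolutely convergent series, with Chen's identity in each
degree. No order of the three times is needed, so it also yields inverses. -/
theorem transition_mul_transition (hA : EntriesIntegrable A) {t s τ : ℝ} (ht : 0 ≤ t)
    (hs : 0 ≤ s) (hτ : 0 ≤ τ) :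
    transition A t s * transition A s τ = transition A t τ := by
  ext i j
  rw [Matrix.mul_apply]
  have h : ∀ k, HasSum (fun n => ∑ p ∈ Finset.HasAntidiagonal.antidiagonal n,
      peanoBaker A p.1 t s i k * peanoBaker A p.2 s τ k j)
      (transition A t s i k * transition A s τ k j) := by
    intro k
    have h1 := summable_abs_peanoBaker hA ht hs i k
    have h2 := summable_abs_peanoBaker hA hs hτ k j
    have h3 := (summable_norm_sum_mul_antidiagonal_of_summable_norm h1 h2).of_norm.hasSum
    rwa [← tsum_mul_tsum_eq_tsum_sum_antidiagonal_of_summable_norm h1 h2] at h3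
  have h4 := hasSum_sum fun k (_ : k ∈ Finset.univ) => h k
  refine h4.unique ((hasSum_transition hA ht hτ i j).congr_fun ?_)
  intro n
  rw [peanoBaker_eq_sum_antidiagonal hA ht hs hτ, Matrix.sum_apply, Finset.sum_comm]
  simp only [Matrix.mul_apply]

theorem transition_self (hA : EntriesIntegrable A) {τ : ℝ} (hτ : 0 ≤ τ) :
    transition A τ τ = 1 := by
  ext i j
  refine (hasSum_transition hA hτ hτ i j).unique ?_
  have : ∀ n, n ≠ 0 → peanoBaker A n τ τ i j = 0 := by
    rintro (_ | n) hn
    · exact absurd rfl hn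
    · simp [peanoBaker_succ_apply]
  simpa [peanoBaker] using hasSum_single 0 this

/-! ### The integral equation for the transition matrix -/

/-- The integral form of the equation `∂Φ/∂t = A Φ`. -/
theorem transition_eq_integral (hA : EntriesIntegrable A) {t τ : ℝ} (ht : 0 ≤ t) (hτ : 0 ≤ τ)
    (i j : Fin N) :
    transition A t τ i j =
      (1 : Matrix (Fin N) (Fin N) ℝ) i j + ∫ s in τ..t, ∑ k, A s i k * transition A s τ k j := by
  -- A bound for the primitive that is uniform in s makes the dominating functions below constant
  -- multiples of `absSum A`, with summable constants.
  set M : ℝ := |∫ s in τ..t, absSum A s|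
  have hM : ∀ s ∈ Set.uIoc τ t, |∫ u in τ..s, absSum A u| ≤ M := by
    intro s hs
    have hsub : Set.uIoc τ s ⊆ Set.uIoc τ t := by
      intro u hu
      rw [Set.mem_uIoc] at *
      grind
    exact intervalIntegral.abs_integral_mono_interval hsub (Eventually.of_forall absSum_nonneg) (hA.absSum τ t hτ ht)
  have hsum : HasSum (fun n => peanoBaker A (n + 1) t τ i j)
      (∫ s in τ..t, ∑ k, A s i k * transition A s τ k j) := by
    simp only [peanoBaker_succ_apply]
    refine intervalIntegral.hasSum_integral_of_dominated_convergence
      (fun n s => absSum A s * (M ^ n / n.factorial)) (fun n => ?_) (fun n => ?_) ?_ ?_ ?_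
    · exact (intervalIntegrable_iff.1
        (intervalIntegrable_mul_peanoBaker hA hτ hτ ht n i j)).aestronglyMeasurable
    · refine Eventually.of_forall fun s hs => ?_
      have hs0 : 0 ≤ s := uIcc_subset_Ici_zero hτ ht (Set.uIoc_subset_uIcc hs)
      refine abs_sum_mul_le s _ _ (fun k => (abs_peanoBaker_le hA hs0 hτ n k j).trans ?_) i
      have := hM s hs
      gcongr
    · exact Eventually.of_forall fun s _ => (Real.summable_pow_div_factorial M).mul_left _
    · simp only [tsum_mul_left]
      exact (hA.absSum τ t hτ ht).mul_const _
    · refine Eventually.of_forall fun s hs => hasSum_sum fun k _ => ?_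
      have hs0 : 0 ≤ s := uIcc_subset_Ici_zero hτ ht (Set.uIoc_subset_uIcc hs)
      exact (hasSum_transition hA hs0 hτ k j).mul_left _
  refine (hasSum_transition hA ht hτ i j).unique ?_
  have := (hasSum_nat_add_iff (f := fun n => peanoBaker A n t τ i j) 1).1 hsum
  simpa [peanoBaker, add_comm] using this

/-- On a compact time interval the primitive of `absSum A` is bounded, so the Weierstrass test gives
uniform convergence. -/
theorem continuousOn_transition (hA : EntriesIntegrable A) {τ : ℝ} (hτ : 0 ≤ τ) (i j : Fin N) :
    ContinuousOn (fun t => transition A t τ i j) (Set.Ici 0) := by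
  have hloc : ∀ T, ContinuousOn (fun t => transition A t τ i j) (Set.Icc 0 T) := by
    intro T
    obtain ⟨C, hC⟩ := isCompact_Icc.exists_bound_of_continuousOn
      ((continuousOn_primitive_Ici hA.absSum hτ).mono (fun _ h => h.1))
    have hbound : ∀ n, ∀ t ∈ Set.Icc 0 T, ‖peanoBaker A n t τ i j‖ ≤ C ^ n / n.factorial := by
      intro n t ht
      rw [Real.norm_eq_abs]
      refine (abs_peanoBaker_le hA ht.1 hτ n i j).trans ?_
      have h := hC t ht
      rw [Real.norm_eq_abs] at h
      exact div_le_div_of_nonneg_right (pow_le_pow_left₀ (abs_nonneg _) h n) (by positivity)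
    have hcont : ∀ n, ContinuousOn (fun t => peanoBaker A n t τ i j) (Set.Icc 0 T) := fun n =>
      (continuousOn_peanoBaker hA hτ n i j).mono fun _ h => h.1
    exact continuousOn_tsum hcont (Real.summable_pow_div_factorial C) hbound
  intro t ht
  have ht : 0 ≤ t := ht
  refine (hloc (t + 1) t ⟨ht, by linarith⟩).mono_of_mem_nhdsWithin ?_
  filter_upwards [self_mem_nhdsWithin,
    mem_nhdsWithin_of_mem_nhds (Iio_mem_nhds (lt_add_one t))] with u hu hu'
  exact ⟨hu, le_of_lt hu'⟩

theorem continuousOn_transition_mulVec (hA : EntriesIntegrable A) {τ : ℝ} (hτ : 0 ≤ τ)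
    (v : Fin N → ℝ) (i : Fin N) :
    ContinuousOn (fun t => (transition A t τ).mulVec v i) (Set.Ici 0) := by
  simp only [Matrix.mulVec, dotProduct]
  exact continuousOn_finsetSum _ fun j _ => (continuousOn_transition hA hτ i j).mul_const _

theorem transition_mulVec_sub (hA : EntriesIntegrable A) {s t τ : ℝ} (hs : 0 ≤ s) (ht : 0 ≤ t)
    (hτ : 0 ≤ τ) (v : Fin N → ℝ) (i : Fin N) :
    (transition A t τ).mulVec v i - (transition A s τ).mulVec v i =
      ∫ u in s..t, ∑ k, A u i k * (transition A u τ).mulVec v k := by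
  have hI : ∀ j, IntervalIntegrable (fun u => ∑ k, A u i k * transition A u τ k j) volume s t :=
    fun j => hA.sum_mul i _ hs ht fun k _ =>
      (continuousOn_transition hA hτ k j).mono (uIcc_subset_Ici_zero hs ht)
  have h1 : ∀ j, transition A t τ i j - transition A s τ i j =
      ∫ u in s..t, ∑ k, A u i k * transition A u τ k j := by
    intro j
    have hI' : ∀ r, 0 ≤ r →
        IntervalIntegrable (fun u => ∑ k, A u i k * transition A u τ k j) volume τ r :=
      fun r hr => hA.sum_mul i _ hτ hr fun k _ =>
        (continuousOn_transition hA hτ k j).mono (uIcc_subset_Ici_zero hτ hr)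
    rw [transition_eq_integral hA ht hτ, transition_eq_integral hA hs hτ,
      ← intervalIntegral.integral_interval_sub_left (hI' t ht) (hI' s hs)]
    ring
  have h2 : ∀ u, ∑ k, A u i k * (transition A u τ).mulVec v k =
      ∑ j, (∑ k, A u i k * transition A u τ k j) * v j := by
    intro u
    simp only [Matrix.mulVec, dotProduct, Finset.mul_sum, Finset.sum_mul]
    rw [Finset.sum_comm]
    simp only [mul_assoc]
  simp only [h2]
  rw [intervalIntegral.integral_finsetSum fun j _ => (hI j).mul_const _]
  simp only [intervalIntegral.integral_mul_const, ← h1, Matrix.mulVec, dotProduct, sub_mul,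
    Finset.sum_sub_distrib]

/-! ### Minimum principle and stochasticity -/

theorem IsTimeChain.entriesIntegrable (hA : IsTimeChain A) : EntriesIntegrable A :=
  hA.locallyIntegrable

theorem intervalIntegrable_sum_mul_sub (hA : EntriesIntegrable A) (i : Fin N)
    {K : Finset (Fin N)} (hi : i ∈ K) {x : Fin N → ℝ → ℝ} {a b : ℝ} (ha : 0 ≤ a) (hb : 0 ≤ b)
    (hx : ∀ j ∈ K, ContinuousOn (x j) (Set.uIcc a b)) :
    IntervalIntegrable (fun s => ∑ j ∈ K, A s i j * (x j s - x i s)) volume a b :=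
  hA.sum_mul i K (x := fun j s => x j s - x i s) ha hb fun j hj => (hx j hj).sub (hx i hi)

/-- A minimum principle: a supersolution of the equation restricted to a set `K` of nodes which
is non-negative initially remains so. -/
theorem nonneg_of_supersolution (hA : IsTimeChain A) {K : Finset (Fin N)} {τ : ℝ} (hτ : 0 ≤ τ)
    {x : Fin N → ℝ → ℝ} (hc : ∀ i ∈ K, ContinuousOn (x i) (Set.Ici τ))
    (h0 : ∀ i ∈ K, 0 ≤ x i τ)
    (hsup : ∀ i ∈ K, ∀ s t, τ ≤ s → s ≤ t →
      ∫ u in s..t, ∑ j ∈ K, A u i j * (x j u - x i u) ≤ x i t - x i s)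
    {t : ℝ} (ht : τ ≤ t) {i : Fin N} (hi : i ∈ K) : 0 ≤ x i t := by
  have hE := hA.entriesIntegrable
  set G : ℝ → ℝ := fun t => ∫ u in τ..t, absSum A u with hG
  have hG0 : ∀ t, τ ≤ t → 0 ≤ G t := fun t ht =>
    intervalIntegral.integral_nonneg_of_forall ht absSum_nonneg
  have hGc : ContinuousOn G (Set.Ici τ) :=
    (continuousOn_primitive_Ici hE.absSum hτ).mono (Set.Ici_subset_Ici.2 hτ)
  -- The perturbation makes the inequality strict, and it grows at rate ε times `absSum A`, enough
  -- to offset the fastest decrease possible near a first zero. At the end ε tends to 0.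
  have key : ∀ ε > 0, ∀ t, τ ≤ t → ∀ i ∈ K, 0 < x i t + ε * (1 + G t) := by
    intro ε hε
    set z : Fin N → ℝ → ℝ := fun i t => x i t + ε * (1 + G t) with hz
    have hzc : ∀ i ∈ K, ContinuousOn (z i) (Set.Ici τ) := fun i hi =>
      (hc i hi).add (continuousOn_const.mul (continuousOn_const.add hGc))
    set B : Set ℝ := ⋃ i ∈ K, {t | t ∈ Set.Ici τ ∧ z i t ≤ 0} with hB
    have hBclosed : IsClosed B := by
      refine K.finite_toSet.isClosed_biUnion fun i hi => ?_
      exact (hzc i hi).preimage_isClosed_of_isClosed isClosed_Ici isClosed_Iic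
    have hBτ : ∀ t ∈ B, τ ≤ t := by
      intro t ht
      simp only [hB, Set.mem_iUnion] at ht
      obtain ⟨i, hi, ht⟩ := ht
      exact ht.1
    by_contra! hcon
    obtain ⟨t, ht, i, hi, hti⟩ := hcon
    have hne : B.Nonempty := ⟨t, by
      simp only [hB, Set.mem_iUnion]
      exact ⟨i, hi, ht, hti⟩⟩
    have hmem := hBclosed.csInf_mem hne ⟨τ, hBτ⟩
    clear! t
    clear! i
    set t₀ := sInf B
    have hbefore : ∀ j ∈ K, ∀ u, τ ≤ u → u < t₀ → 0 < z j u := by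
      intro j hj u hu hut
      by_contra! h
      refine absurd (csInf_le ⟨τ, hBτ⟩ (show u ∈ B from ?_)) (not_le.2 hut)
      simp only [hB, Set.mem_iUnion]
      exact ⟨j, hj, hu, h⟩
    simp only [hB, Set.mem_iUnion] at hmem
    obtain ⟨i, hi, ht₀, hzi⟩ := hmem
    have ht₀ : τ ≤ t₀ := ht₀
    have hlt : τ < t₀ := by
      refine lt_of_le_of_ne ht₀ fun h => ?_
      rw [← h] at hzi
      have h1 := h0 i hi
      have h2 : z i τ = x i τ + ε := by simp [hz, hG]
      linarith
    -- Just before the first bad time every z j is positive while z i is at most ε. The perturbation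
    -- is common to all nodes, so x j - x i ≥ -ε there.
    have hnear : ∃ s, τ ≤ s ∧ s < t₀ ∧ ∀ u, s < u → u < t₀ → z i u ≤ ε := by
      have h1 : ∀ᶠ u in 𝓝[Set.Ici τ] t₀, z i u < ε :=
        (hzc i hi t₀ ht₀).eventually_lt_const (lt_of_le_of_lt hzi hε)
      rw [(nhdsWithin_eq_nhds.2 (Ici_mem_nhds hlt))] at h1
      obtain ⟨l, hl, h⟩ := exists_Ioc_subset_of_mem_nhds h1 ⟨τ, hlt⟩
      exact ⟨max τ l, le_max_left _ _, max_lt hlt hl, fun u hu hu' =>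
        le_of_lt (h ⟨(le_max_right _ _).trans_lt hu, hu'.le⟩)⟩
    obtain ⟨s, hs, hst, hle⟩ := hnear
    have hs0 := hτ.trans hs
    have ht0 := hτ.trans ht₀
    have hsub : Set.uIcc s t₀ ⊆ Set.Ici τ := by
      rw [Set.uIcc_of_le hst.le]
      exact fun u hu => hs.trans hu.1
    have hlower : ∫ u in s..t₀, -ε * absSum A u ≤
        ∫ u in s..t₀, ∑ j ∈ K, A u i j * (x j u - x i u) := by
      refine intervalIntegral.integral_mono_on_of_le_Ioo hst.le
        ((hE.absSum s t₀ hs0 ht0).const_mul _)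
        (intervalIntegrable_sum_mul_sub hE i hi hs0 ht0 fun j hj => (hc j hj).mono hsub) ?_
      intro u hu
      have hu0 : 0 ≤ u := hs0.trans hu.1.le
      have hterm : ∀ j ∈ K, -ε * |A u i j| ≤ A u i j * (x j u - x i u) := by
        intro j hj
        by_cases hij : i = j
        · subst hij
          have := mul_nonneg hε.le (abs_nonneg (A u i i))
          simp only [sub_self, mul_zero]
          linarith
        · have ha := hA.offDiag_nonneg u hu0 i j hij
          have h1 := hbefore j hj u (hs.trans hu.1.le) hu.2
          have h2 := hle u hu.1 hu.2
          have h3 : -ε ≤ x j u - x i u := by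
            simp only [hz] at h1 h2
            linarith
          rw [abs_of_nonneg ha, mul_comm]
          exact mul_le_mul_of_nonneg_left h3 ha
      refine le_trans ?_ (Finset.sum_le_sum hterm)
      rw [← Finset.mul_sum]
      refine mul_le_mul_of_nonpos_left ?_ (by linarith)
      exact (Finset.sum_le_sum_of_subset_of_nonneg (Finset.subset_univ K)
        fun _ _ _ => abs_nonneg _).trans (sum_abs_row_le_absSum u i)
    have hGd : G t₀ - G s = ∫ u in s..t₀, absSum A u :=
      intervalIntegral.integral_interval_sub_left (hE.absSum τ t₀ hτ ht0) (hE.absSum τ s hτ hs0)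
    rw [intervalIntegral.integral_const_mul, ← hGd] at hlower
    -- The drop of x i from s to t₀ is at most ε times the increment of G, so z i t₀ ≥ z i s > 0,
    -- contradicting the choice of t₀.
    have h1 := hsup i hi s t₀ hs hst.le
    have h2 := hbefore i hi s hs hst
    simp only [hz] at h2 hzi
    nlinarith
  refine ge_of_tendsto (x := 𝓝[>] (0 : ℝ)) (f := fun ε => x i t + ε * (1 + G t)) ?_ ?_
  · have : Tendsto (fun ε : ℝ => x i t + ε * (1 + G t)) (𝓝 0) (𝓝 (x i t + 0 * (1 + G t))) :=
      (Continuous.tendsto (by fun_prop) 0)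
    simpa using this.mono_left nhdsWithin_le_nhds
  · filter_upwards [self_mem_nhdsWithin] with ε hε
    exact (key ε hε t ht i hi).le

theorem sum_mul_sub_eq (hA : IsTimeChain A) {t : ℝ} (ht : 0 ≤ t) (x : Fin N → ℝ) (i : Fin N) :
    ∑ j, A t i j * (x j - x i) = ∑ j, A t i j * x j := by
  simp only [mul_sub, Finset.sum_sub_distrib, ← Finset.sum_mul, hA.row_sum t ht i, zero_mul,
    sub_zero]

/-- Zero row sums turn the equation into one in the differences x j - x i, so the minimum principle
applies with K the set of all nodes and equality in the supersolution condition. -/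
theorem transition_mulVec_nonneg (hA : IsTimeChain A) {t τ : ℝ} (hτ : 0 ≤ τ) (ht : τ ≤ t)
    {v : Fin N → ℝ} (hv : ∀ i, 0 ≤ v i) (i : Fin N) : 0 ≤ (transition A t τ).mulVec v i := by
  have hE := hA.entriesIntegrable
  refine nonneg_of_supersolution hA (K := Finset.univ) hτ
    (x := fun i t => (transition A t τ).mulVec v i)
    (fun j _ => (continuousOn_transition_mulVec hE hτ v j).mono (Set.Ici_subset_Ici.2 hτ))
    (fun j _ => ?_) (fun j _ s t hs hst => ?_) ht (Finset.mem_univ i)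
  · simpa [transition_self hE hτ] using hv j
  · rw [transition_mulVec_sub hE (hτ.trans hs) (hτ.trans (hs.trans hst)) hτ]
    refine le_of_eq (intervalIntegral.integral_congr fun u hu => ?_)
    exact sum_mul_sub_eq hA
      (uIcc_subset_Ici_zero (hτ.trans hs) (hτ.trans (hs.trans hst)) hu) _ j

/-- The first-order term inherits the zero row sums of A; afterwards A is applied to a vector of row
sums that is already zero. -/
theorem sum_peanoBaker_succ (hA : IsTimeChain A) {t τ : ℝ} (ht : 0 ≤ t) (hτ : 0 ≤ τ) (n : ℕ)
    (i : Fin N) : ∑ j, peanoBaker A (n + 1) t τ i j = 0 := by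
  have hE := hA.entriesIntegrable
  induction n generalizing t i with
  | zero =>
    simp only [peanoBaker_succ_apply]
    rw [← intervalIntegral.integral_finsetSum fun j _ =>
      intervalIntegrable_mul_peanoBaker hE hτ hτ ht 0 i j]
    refine (intervalIntegral.integral_congr fun u hu => ?_).trans
      intervalIntegral.integral_zero
    simp only [peanoBaker, Matrix.one_apply, mul_ite, mul_one, mul_zero, Finset.sum_ite_eq',
      Finset.mem_univ, if_true]
    exact hA.row_sum u (uIcc_subset_Ici_zero hτ ht hu) i
  | succ n ih =>
    simp only [peanoBaker_succ_apply (n + 1)]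
    rw [← intervalIntegral.integral_finsetSum fun j _ =>
      intervalIntegrable_mul_peanoBaker hE hτ hτ ht (n + 1) i j]
    refine (intervalIntegral.integral_congr fun u hu => ?_).trans
      intervalIntegral.integral_zero
    rw [Finset.sum_comm]
    simp only [← Finset.mul_sum, ih (uIcc_subset_Ici_zero hτ ht hu), mul_zero,
      Finset.sum_const_zero]

/-- The state transition matrix has unit row sums. -/
theorem transition_mulVec_one (hA : IsTimeChain A) {t τ : ℝ} (ht : 0 ≤ t) (hτ : 0 ≤ τ) :
    (transition A t τ).mulVec 1 = 1 := by
  funext i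
  have h := hasSum_sum fun j (_ : j ∈ Finset.univ) =>
    hasSum_transition hA.entriesIntegrable ht hτ i j
  have h2 : HasSum (fun n => ∑ j, peanoBaker A n t τ i j) 1 := by
    have := hasSum_single (f := fun n => ∑ j, peanoBaker A n t τ i j) 0 (by
      rintro (_ | n) hn
      · exact absurd rfl hn
      · exact sum_peanoBaker_succ hA ht hτ n i)
    simpa [peanoBaker, Matrix.one_apply] using this
  simpa [Matrix.mulVec, dotProduct] using h.unique h2

theorem transition_mulVec_le_one (hA : IsTimeChain A) {t τ : ℝ} (hτ : 0 ≤ τ) (ht : τ ≤ t)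
    {v : Fin N → ℝ} (hv : ∀ i, v i ≤ 1) (i : Fin N) : (transition A t τ).mulVec v i ≤ 1 := by
  have h := transition_mulVec_nonneg hA hτ ht (v := 1 - v) (fun j => by simpa using hv j) i
  rw [Matrix.mulVec_sub, transition_mulVec_one hA (hτ.trans ht) hτ] at h
  simpa using h

/-! ### Inflow into a set of nodes -/

/-- The total influence of the nodes outside `K` on the nodes in `K`. -/
noncomputable def inflow (A : ℝ → Matrix (Fin N) (Fin N) ℝ) (K : Finset (Fin N)) (t : ℝ) : ℝ :=
  ∑ i ∈ K, ∑ j ∈ Kᶜ, A t i j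

theorem inflow_nonneg (hA : IsTimeChain A) (K : Finset (Fin N)) {t : ℝ} (ht : 0 ≤ t) :
    0 ≤ inflow A K t := by
  refine Finset.sum_nonneg fun i hi => Finset.sum_nonneg fun j hj => ?_
  exact hA.offDiag_nonneg t ht i j fun h => Finset.mem_compl.1 hj (h ▸ hi)

theorem intervalIntegrable_inflow (hA : EntriesIntegrable A) (K : Finset (Fin N)) (a b : ℝ)
    (ha : 0 ≤ a) (hb : 0 ≤ b) : IntervalIntegrable (inflow A K) volume a b := by
  have : inflow A K = ∑ i ∈ K, ∑ j ∈ Kᶜ, fun t => A t i j := by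
    funext t
    simp [inflow]
  rw [this]
  exact IntervalIntegrable.sum _ fun i _ => IntervalIntegrable.sum _ fun j _ =>
    hA.entry i j a b ha hb

/-- Mass initially placed on `K` leaks at most at the rate of the inflow. -/
theorem one_sub_integral_inflow_le (hA : IsTimeChain A) (K : Finset (Fin N)) {t τ : ℝ}
    (hτ : 0 ≤ τ) (ht : τ ≤ t) {i : Fin N} (hi : i ∈ K) :
    1 - ∫ s in τ..t, inflow A K s ≤
      (transition A t τ).mulVec (fun j => if j ∈ K then 1 else 0) i := by
  have hE := hA.entriesIntegrable
  set v : Fin N → ℝ := fun j => if j ∈ K then 1 else 0 with hv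
  have hv0 : ∀ j, 0 ≤ v j := fun j => by
    simp only [hv]
    split_ifs <;> norm_num
  have hv1 : ∀ j, v j ≤ 1 := fun j => by
    simp only [hv]
    split_ifs <;> norm_num
  set y : Fin N → ℝ → ℝ := fun j t => (transition A t τ).mulVec v j with hy
  have hyc : ∀ j, ContinuousOn (y j) (Set.Ici τ) := fun j =>
    (continuousOn_transition_mulVec hE hτ v j).mono (Set.Ici_subset_Ici.2 hτ)
  -- The deficit on K plus the accumulated inflow starts at 0 on K and is a supersolution of the
  -- equation restricted to K, so the minimum principle keeps it non-negative.
  set w : Fin N → ℝ → ℝ := fun j t => y j t - 1 + ∫ s in τ..t, inflow A K s with hw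
  have hwc : ∀ j, ContinuousOn (w j) (Set.Ici τ) := fun j =>
    ((hyc j).sub continuousOn_const).add
      ((continuousOn_primitive_Ici (intervalIntegrable_inflow hE K) hτ).mono
        (Set.Ici_subset_Ici.2 hτ))
  suffices h : 0 ≤ w i t by
    simp only [hw, hy] at h
    linarith
  refine nonneg_of_supersolution hA (K := K) hτ (x := w) (fun j _ => hwc j) (fun j hj => ?_)
    (fun j hj s t hs hst => ?_) ht hi
  · simp [hw, hy, transition_self hE hτ, hv, hj]
  · have hs0 := hτ.trans hs
    have ht0 := hs0.trans hst
    have hsub : Set.uIcc s t ⊆ Set.Ici τ := by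
      rw [Set.uIcc_of_le hst]
      exact fun u hu => hs.trans hu.1
    have hdiff : w j t - w j s =
        (∫ u in s..t, ∑ k, A u j k * y k u) + ∫ u in s..t, inflow A K u := by
      rw [← transition_mulVec_sub hE hs0 ht0 hτ v j,
        ← intervalIntegral.integral_interval_sub_left
          (intervalIntegrable_inflow hE K τ t hτ ht0) (intervalIntegrable_inflow hE K τ s hτ hs0)]
      simp only [hw, hy]
      ring
    have hI1 := hE.sum_mul j Finset.univ (x := y) hs0 ht0 fun k _ => (hyc k).mono hsub
    have hI2 := intervalIntegrable_inflow hE K s t hs0 ht0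
    rw [hdiff, ← intervalIntegral.integral_add hI1 hI2]
    refine intervalIntegral.integral_mono_on hst
      (intervalIntegrable_sum_mul_sub hE j hj hs0 ht0 fun k _ => (hwc k).mono hsub)
      (hI1.add hI2) fun u hu => ?_
    have hu0 : 0 ≤ u := hs0.trans hu.1
    have huτ : τ ≤ u := hs.trans hu.1
    rw [← sum_mul_sub_eq hA hu0 (fun k => y k u) j, ← Finset.sum_add_sum_compl K]
    have h1 : ∑ k ∈ K, A u j k * (w k u - w j u) = ∑ k ∈ K, A u j k * (y k u - y j u) := by
      refine Finset.sum_congr rfl fun k _ => ?_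
      simp only [hw]
      ring
    have hoff : ∀ a ∈ K, ∀ k ∈ Kᶜ, 0 ≤ A u a k := fun a ha k hk =>
      hA.offDiag_nonneg u hu0 a k fun h => Finset.mem_compl.1 hk (h ▸ ha)
    -- All values lie between 0 and 1, so an outside node pulls node j down at a rate no larger than
    -- its weight; the inflow term in w pays for this.
    have h2 : -∑ k ∈ Kᶜ, A u j k ≤ ∑ k ∈ Kᶜ, A u j k * (y k u - y j u) := by
      rw [← Finset.sum_neg_distrib]
      refine Finset.sum_le_sum fun k hk => ?_
      have h3 := hoff j hj k hk
      have h4 : 0 ≤ y k u := transition_mulVec_nonneg hA hτ huτ hv0 k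
      have h5 : y j u ≤ 1 := transition_mulVec_le_one hA hτ huτ hv1 j
      nlinarith
    have h6 : ∑ k ∈ Kᶜ, A u j k ≤ inflow A K u :=
      Finset.single_le_sum (f := fun a => ∑ k ∈ Kᶜ, A u a k)
        (fun a ha => Finset.sum_nonneg fun k hk => hoff a ha k hk) hj
    rw [h1]
    linarith

/-- If no edge of the unbounded interactions graph enters `K`, the tails of the inflow into `K`
are eventually small. -/
theorem eventually_integral_inflow_le (hA : IsTimeChain A) {K : Finset (Fin N)}
    (hK : ∀ i j, (unboundedInteractions A).Adj i j → j ∈ K → i ∈ K) {ε : ℝ} (hε : 0 < ε) :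
    ∀ᶠ τ in atTop, ∀ t, τ ≤ t → ∫ s in τ..t, inflow A K s ≤ ε := by
  have hE := hA.entriesIntegrable
  have hint : IntegrableOn (inflow A K) (Set.Ioi 0) := by
    refine IntegrableOn.mono_set ?_ Set.Ioi_subset_Ici_self
    refine integrable_finsetSum _ fun i hi => integrable_finsetSum _ fun j hj => ?_
    have hij : j ≠ i := fun h => Finset.mem_compl.1 hj (h ▸ hi)
    -- An infinite integral would be an edge entering K from j, which `hK` excludes.
    have hfin : ∫⁻ t in Set.Ici (0 : ℝ), ENNReal.ofReal (A t i j) ≠ ⊤ := fun h =>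
      Finset.mem_compl.1 hj (hK j i ⟨hij, h⟩ hi)
    refine ⟨(hA.locallyIntegrable i j).aestronglyMeasurable, ?_⟩
    rw [hasFiniteIntegral_iff_ofReal]
    · exact hfin.lt_top
    · filter_upwards [self_mem_ae_restrict measurableSet_Ici] with t ht
      exact hA.offDiag_nonneg t ht i j hij.symm
  have hlim := intervalIntegral_tendsto_integral_Ioi 0 hint tendsto_id
  filter_upwards [hlim.eventually_const_lt (sub_lt_self _ hε), eventually_ge_atTop 0]
    with τ h1 hτ t ht
  have h2 : ∫ s in (0 : ℝ)..t, inflow A K s ≤ ∫ s in Set.Ioi 0, inflow A K s := by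
    rw [intervalIntegral.integral_of_le (hτ.trans ht)]
    refine setIntegral_mono_set hint ?_ Set.Ioc_subset_Ioi_self.eventuallyLE
    filter_upwards [self_mem_ae_restrict measurableSet_Ioi] with s hs
    exact inflow_nonneg hA K (le_of_lt hs)
  have h3 := intervalIntegral.integral_interval_sub_left
    (intervalIntegrable_inflow hE K 0 t le_rfl (hτ.trans ht))
    (intervalIntegrable_inflow hE K 0 τ le_rfl hτ)
  simp only [id] at h1
  linarith

/-! ### Null spaces, minimal s-roots and the dimension count -/

/-- The null spaces at different times are isomorphic. -/
theorem finrank_nullSpace_eq (hA : EntriesIntegrable A) {τ : ℝ} (hτ : 0 ≤ τ) :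
    Module.finrank ℝ (nullSpace A τ) = nullity A := by
  have h1 : transition A τ 0 * transition A 0 τ = 1 := by
    rw [transition_mul_transition hA hτ le_rfl hτ, transition_self hA hτ]
  have h2 : transition A 0 τ * transition A τ 0 = 1 := by
    rw [transition_mul_transition hA le_rfl hτ le_rfl, transition_self hA le_rfl]
  let e : (Fin N → ℝ) ≃ₗ[ℝ] (Fin N → ℝ) := Matrix.toLin'OfInv h2 h1
  have he_apply : ∀ v, (e : (Fin N → ℝ) →ₗ[ℝ] (Fin N → ℝ)) v = (transition A τ 0).mulVec v :=
    fun v => Matrix.toLin'_apply _ v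
  have he : (nullSpace A 0).map (e : (Fin N → ℝ) →ₗ[ℝ] (Fin N → ℝ)) = nullSpace A τ := by
    -- For t ≥ 0 the trajectory of v from time 0 is the trajectory of Φ(τ, 0) v from time τ, so both
    -- decay or neither does.
    have hshift : ∀ v, v ∈ nullSpace A 0 ↔ (transition A τ 0).mulVec v ∈ nullSpace A τ := by
      intro v
      refine tendsto_congr' ?_
      filter_upwards [eventually_ge_atTop 0] with t ht
      rw [Matrix.mulVec_mulVec, transition_mul_transition hA ht hτ le_rfl]
    ext w
    rw [Submodule.mem_map]
    constructor
    · rintro ⟨v, hv, rfl⟩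
      rw [he_apply]
      exact (hshift v).1 hv
    · intro hw
      refine ⟨(transition A 0 τ).mulVec w, ?_, ?_⟩
      · rw [hshift, Matrix.mulVec_mulVec, h1, Matrix.one_mulVec]
        exact hw
      · rw [he_apply, Matrix.mulVec_mulVec, h1, Matrix.one_mulVec]
  rw [← he]
  exact LinearEquiv.finrank_map_eq e _

/-- In a smallest s-root, no node is reachable from two members. -/
theorem eq_of_reaches_of_card_eq_minSRootSize {V : Type*} {H : Digraph V} {S : Finset V}
    (hS : IsSRoot H S) (hcard : S.card = minSRootSize H) {r r' j : V} (hr : r ∈ S) (hr' : r' ∈ S)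
    (h : Relation.ReflTransGen H.Adj j r) (h' : Relation.ReflTransGen H.Adj j r') : r = r' := by
  classical
  by_contra hne
  -- Exchanging r and r' for j removes two nodes and adds at most one, and everything reached from r
  -- or r' is reached from j.
  have hlt : (insert j ((S.erase r).erase r')).card < S.card := by
    have h1 := Finset.card_insert_le j ((S.erase r).erase r')
    have h2 : r' ∈ S.erase r := Finset.mem_erase.2 ⟨Ne.symm hne, hr'⟩
    have h3 := Finset.card_erase_add_one h2
    have h4 := Finset.card_erase_add_one hr
    omega
  rw [hcard] at hlt
  suffices h : IsSRoot H (insert j ((S.erase r).erase r')) from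
    absurd (show minSRootSize H ≤ _ from Nat.sInf_le ⟨_, h, rfl⟩) (not_le.2 hlt)
  have hreach : ∀ s ∈ S, ∃ k ∈ insert j ((S.erase r).erase r'),
      Relation.ReflTransGen H.Adj k s := by
    intro s hs
    by_cases hsr : s = r
    · exact ⟨j, Finset.mem_insert_self _ _, hsr ▸ h⟩
    by_cases hsr' : s = r'
    · exact ⟨j, Finset.mem_insert_self _ _, hsr' ▸ h'⟩
    exact ⟨s, by simp [hsr, hsr', hs], .refl⟩
  intro i
  obtain ⟨k, hk, hki⟩ : ∃ k ∈ insert j ((S.erase r).erase r'),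
      Relation.ReflTransGen H.Adj k i := by
    rcases hS i with hi | ⟨s, hs, hsi⟩
    · exact hreach i hi
    · obtain ⟨k, hk, hks⟩ := hreach s hs
      exact ⟨k, hk, hks.trans hsi.to_reflTransGen⟩
  rcases Relation.reflTransGen_iff_eq_or_transGen.1 hki with h | h
  · exact Or.inl (h ▸ hk)
  · exact Or.inr ⟨k, hk, h⟩

/-- Disjoint sets of nodes which no edge of the unbounded interactions graph enters, each with a
chosen member, bound the nullity from above. -/
theorem card_add_nullity_le (hA : IsTimeChain A) (S : Finset (Fin N))
    (K : Fin N → Finset (Fin N)) (hmem : ∀ r ∈ S, r ∈ K r)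
    (hdisj : ∀ r ∈ S, ∀ r' ∈ S, ∀ j, j ∈ K r → j ∈ K r' → r = r')
    (hclosed : ∀ r ∈ S, ∀ i j, (unboundedInteractions A).Adj i j → j ∈ K r → i ∈ K r) :
    S.card + nullity A ≤ N := by
  have hE := hA.entriesIntegrable
  -- Any bound δ < 1/2 would do: the final estimate leaves the factor 1 - 2δ.
  obtain ⟨τ, hsmall, hτ⟩ : ∃ τ : ℝ, (∀ r ∈ S, ∀ t, τ ≤ t → ∫ s in τ..t, inflow A (K r) s ≤ 1 / 4)
      ∧ 0 ≤ τ := by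
    have h1 : ∀ᶠ τ in atTop, ∀ r ∈ S, ∀ t, τ ≤ t → ∫ s in τ..t, inflow A (K r) s ≤ 1 / 4 :=
      (Finset.eventually_all S).2 fun r hr =>
        eventually_integral_inflow_le hA (hclosed r hr) (by norm_num)
    exact (h1.and (eventually_ge_atTop 0)).exists
  let v : Fin N → Fin N → ℝ := fun r j => if j ∈ K r then 1 else 0
  let f : (S → ℝ) →ₗ[ℝ] (Fin N → ℝ) := Fintype.linearCombination ℝ fun r : S => v r
  have hf : ∀ c, f c = ∑ r : S, c r • v r := fun c => Fintype.linearCombination_apply ℝ _ c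
  have hv0 : ∀ r j, 0 ≤ v r j := fun r j => by
    simp only [v]
    split_ifs <;> norm_num
  -- Disjointness of the sets K r bounds the sum of their indicators by 1, and the transition matrix
  -- preserves this bound.
  have hvsum : ∀ j, (∑ r : S, v r) j ≤ 1 := by
    intro j
    rw [Finset.sum_apply]
    by_cases hj : ∃ r : S, j ∈ K r
    · obtain ⟨r, hr⟩ := hj
      rw [Finset.sum_eq_single r]
      · simp [v, hr]
      · intro r' _ hne
        simp only [v, ite_eq_right_iff, one_ne_zero, imp_false]
        exact fun hr' => hne (Subtype.ext (hdisj r' r'.2 r r.2 j hr' hr))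
      · simp
    · push Not at hj
      simp [v, hj]
  have hnull : ∀ c, f c ∈ nullSpace A τ → c = 0 := by
    intro c hc
    by_contra hne
    have hnonempty : Nonempty S := by
      by_contra h
      rw [not_nonempty_iff] at h
      exact hne (Subsingleton.elim _ _)
    -- At a node with maximal |c r|, the own indicator contributes at least 3/4 of |c r| and the
    -- others at most 1/4 of it.
    obtain ⟨r, hr⟩ := Finite.exists_max fun r : S => |c r|
    have hcr : 0 < |c r| := by
      rw [abs_pos]
      intro h0
      refine hne (funext fun s => ?_)
      have := hr s
      rw [h0, abs_zero] at this
      exact abs_nonpos_iff.1 this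
    have hlow : ∀ t, τ ≤ t → |c r| / 2 ≤ |(transition A t τ).mulVec (f c) r| := by
      intro t ht
      set p : S → ℝ := fun s => (transition A t τ).mulVec (v s) r with hp
      have hp0 : ∀ s, 0 ≤ p s := fun s => transition_mulVec_nonneg hA hτ ht (hv0 s) r
      have hp1 : ∑ s, p s ≤ 1 := by
        have := transition_mulVec_le_one hA hτ ht hvsum r
        rwa [Matrix.mulVec_sum, Finset.sum_apply] at this
      have hpr : 3 / 4 ≤ p r := by
        have h1 := one_sub_integral_inflow_le hA (K r) hτ ht (hmem r r.2)
        have h2 := hsmall r r.2 t ht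
        simp only [hp, v]
        linarith
      have hx : (transition A t τ).mulVec (f c) r = ∑ s, c s * p s := by
        rw [hf, Matrix.mulVec_sum, Finset.sum_apply]
        simp [Matrix.mulVec_smul, hp]
      rw [hx, ← Finset.add_sum_erase _ _ (Finset.mem_univ r)]
      rw [← Finset.add_sum_erase _ _ (Finset.mem_univ r)] at hp1
      have hrest : |∑ s ∈ Finset.univ.erase r, c s * p s| ≤
          |c r| * ∑ s ∈ Finset.univ.erase r, p s := by
        rw [Finset.mul_sum]
        refine (Finset.abs_sum_le_sum_abs _ _).trans (Finset.sum_le_sum fun s _ => ?_)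
        rw [abs_mul, abs_of_nonneg (hp0 s)]
        exact mul_le_mul_of_nonneg_right (hr s) (hp0 s)
      have h3 := abs_sub_abs_le_abs_add (c r * p r) (∑ s ∈ Finset.univ.erase r, c s * p s)
      rw [abs_mul, abs_of_nonneg (hp0 r)] at h3
      nlinarith
    have hlim : Tendsto (fun t => |(transition A t τ).mulVec (f c) r|) atTop (𝓝 0) := by
      have h1 : Tendsto (fun t => (transition A t τ).mulVec (f c)) atTop (𝓝 0) := hc
      simpa using ((tendsto_pi_nhds.1 h1) r).abs
    have := ge_of_tendsto hlim ((eventually_ge_atTop τ).mono hlow)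
    linarith
  have hinj : Function.Injective f := by
    rw [← LinearMap.ker_eq_bot, LinearMap.ker_eq_bot']
    intro c hc
    exact hnull c (hc ▸ Submodule.zero_mem _)
  have hd : Disjoint (LinearMap.range f) (nullSpace A τ) := by
    rw [Submodule.disjoint_def]
    rintro _ ⟨c, rfl⟩ hc
    rw [hnull c hc, map_zero]
  have h := Submodule.finrank_add_finrank_le_of_disjoint hd
  rw [LinearMap.finrank_range_of_inj hinj, finrank_nullSpace_eq hE hτ] at h
  simpa using h

end OpinionNetwork

theorem theorem3 (N : ℕ) (A : ℝ → Matrix (Fin N) (Fin N) ℝ)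
    (hA : OpinionNetwork.IsTimeChain A) :
    (∀ τ : ℝ, 0 ≤ τ →
      Module.finrank ℝ (OpinionNetwork.nullSpace A τ) = OpinionNetwork.nullity A) ∧
    OpinionNetwork.minSRootSize (OpinionNetwork.unboundedInteractions A) ≤
      OpinionNetwork.rank A := by
  classical
  refine ⟨fun τ hτ => OpinionNetwork.finrank_nullSpace_eq hA.entriesIntegrable hτ, ?_⟩
  obtain ⟨S, hS, hcard⟩ :=
    OpinionNetwork.exists_isSRoot_card_eq (OpinionNetwork.unboundedInteractions A)
  have h := OpinionNetwork.card_add_nullity_le hA S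
    (fun r => {j | Relation.ReflTransGen (OpinionNetwork.unboundedInteractions A).Adj j r})
    (fun r _ => Finset.mem_filter.2 ⟨Finset.mem_univ r, .refl⟩)
    (fun r hr r' hr' j hj hj' => OpinionNetwork.eq_of_reaches_of_card_eq_minSRootSize hS hcard hr
      hr' (Finset.mem_filter.1 hj).2 (Finset.mem_filter.1 hj').2)
    (fun r _ i j hij hj => Finset.mem_filter.2
      ⟨Finset.mem_univ i, .head hij (Finset.mem_filter.1 hj).2⟩)
  rw [← hcard, OpinionNetwork.rank]
  omega
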